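/- For integers $0\le k\le n$ let $$c(n,k)=2\sum_{m=1}^{n}\frac{(-1)^{m-1}}{m^2}+\sum_{m=1}^{k}\frac{(-1)^{n+m-1}}{m^2\binom{n}{m}\binom{n+m}{m}},$$ which is the potential, with $c(0,0)=0$, of the WZ form for $\zeta(2)$ $$\frac{(-1)^{n+k}\,k!^2\,(n-k-1)!}{(n+1)\,(n+k+1)!}\,\bigl[(n+1)\,\delta k+2(n-k)\,\delta n\bigr];$$ that is, $c(n,k+1)-c(n,k)$ (for $k<n$) and $c(n+1,k)-c(n,k)$ (for $k\le n$) are the coefficients of $\delta k$ and of $\delta n$ in it, where $(n-k)\,(n-k-1)!$ is read as $(n-k)!$. Theorem. For every integer $d\ge 3$ put $$A^{(d)}(n)=\sum_{k=0}^{n}\binom{n}{k}^{d},\qquad B^{(d)}(n)=\frac1{d+1}\sum_{k=0}^{n}\binom{n}{k}^{d}c(n,k)\qquad(n\ge 0).$$ Then there are an integer $L\ge 0$ and polynomials $p_0,\dots,p_L$ with rational coefficients (depending on $d$), with $p_L(n)\ne 0$ for every integer $n\ge 0$, such that $u=A^{(d)}$ and $u=B^{(d)}$ both satisfy the recurrence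 $$\sum_{i=0}^{L}p_i(n)\,u(n+i)=0\qquad\text{for all } n\ge 0$$ (which is not claimed to be of minimal order). In particular, $B^{(d)}$ is the solution of this recurrence with the rational initial values $B^{(d)}(0),\dots,B^{(d)}(L-1)$. Moreover, there are real numbers $C$ and $\alpha>1$ (depending on $d$) such that $$\left|\frac{B^{(d)}(n)}{A^{(d)}(n)}-\frac{\zeta(2)}{d+1}\right|\le\frac{C}{\alpha^{n}}\qquad\text{for all } n\ge 0.$$ -/

import Mathlib

/-- The `δk`-component `F(n,k) = (-1)^(n+k) k!² (n-k-1)! / (n+k+1)!` (for `0 ≤ k < n`) of the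
WZ form for `ζ(2)`,
`(-1)^(n+k) k!² (n-k-1)! / ((n+1) (n+k+1)!) * ((n+1) δk + 2 (n-k) δn)`. -/
def wzF (n k : ℕ) : ℚ :=
  (-1) ^ (n + k) * (k.factorial : ℚ) ^ 2 * ((n - k - 1).factorial : ℚ)
    / ((n + k + 1).factorial : ℚ)

/-- The `δn`-component of the same form, with `(n-k) * (n-k-1)!` written as `(n-k)!`, which
gives it its meaning for `k = n` as well (so it is used for `0 ≤ k ≤ n`). -/
def wzG (n k : ℕ) : ℚ :=
  2 * (-1) ^ (n + k) * (k.factorial : ℚ) ^ 2 * ((n - k).factorial : ℚ)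
    / (((n : ℚ) + 1) * ((n + k + 1).factorial : ℚ))

/-- The potential
`c(n,k) = 2 ∑_{m=1}^n (-1)^(m-1)/m² + ∑_{m=1}^k (-1)^(n+m-1) / (m² C(n,m) C(n+m,m))`
of the WZ form for `ζ(2)`, for `0 ≤ k ≤ n`. -/
def wzPotential (n k : ℕ) : ℚ :=
  2 * (∑ m ∈ Finset.Icc 1 n, (-1 : ℚ) ^ (m - 1) / (m : ℚ) ^ 2)
    + ∑ m ∈ Finset.Icc 1 k,
        (-1 : ℚ) ^ (n + m - 1) / ((m : ℚ) ^ 2 * (n.choose m : ℚ) * ((n + m).choose m : ℚ))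

theorem wzPotential_zero_zero : wzPotential 0 0 = 0 := by
  simp [wzPotential]

/-- `c(n,k+1) - c(n,k) = F(n,k)`. -/
theorem wzPotential_sub_k (n k : ℕ) (h : k < n) :
    wzPotential n (k + 1) - wzPotential n k = wzF n k := by
  obtain ⟨j, rfl⟩ := Nat.exists_eq_add_of_lt h
  have e1 : k + j + 1 - k - 1 = j := by omega
  have e2 : k + j + 1 + (k + 1) - 1 = k + j + 1 + k := by omega
  have e3 : k + j + 1 - (k + 1) = j := by omega
  have e4 : k + j + 1 + (k + 1) = k + j + 1 + k + 1 := by omega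
  unfold wzPotential wzF
  rw [Finset.sum_Icc_succ_top (show 1 ≤ k + 1 by omega), Nat.cast_choose ℚ (show k + 1 ≤ k + j + 1 by omega),
    Nat.cast_choose ℚ (show k + 1 ≤ k + j + 1 + (k + 1) by omega), Nat.add_sub_cancel, e1, e2,
    e3, e4]
  have a1 : ((k + 1).factorial : ℚ) = ((k : ℚ) + 1) * (k.factorial : ℚ) := by
    rw [Nat.factorial_succ]; push_cast; ring
  have p1 : (k.factorial : ℚ) ≠ 0 := by exact_mod_cast k.factorial_ne_zero
  have p2 : (j.factorial : ℚ) ≠ 0 := by exact_mod_cast j.factorial_ne_zero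
  have p3 : ((k + j + 1).factorial : ℚ) ≠ 0 := by exact_mod_cast (k + j + 1).factorial_ne_zero
  have p4 : ((k + j + 1 + k + 1).factorial : ℚ) ≠ 0 := by
    exact_mod_cast (k + j + 1 + k + 1).factorial_ne_zero
  have p5 : (k : ℚ) + 1 ≠ 0 := by positivity
  rw [a1]
  push_cast
  field_simp
  ring

/-- `c(n+1,k) - c(n,k) = G(n,k)`. -/
theorem wzPotential_sub_n (n k : ℕ) (h : k ≤ n) :
    wzPotential (n + 1) k - wzPotential n k = wzG n k := by
  induction k with
  | zero =>
    have p1 : (n.factorial : ℚ) ≠ 0 := by exact_mod_cast n.factorial_ne_zero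
    have p2 : (n : ℚ) + 1 ≠ 0 := by positivity
    unfold wzPotential wzG
    rw [Finset.sum_Icc_succ_top (by omega)]
    simp [Nat.factorial_succ]
    field_simp
    ring
  | succ k ih =>
    have i0 := ih (by omega)
    have i1 := wzPotential_sub_k n k (by omega)
    have i2 := wzPotential_sub_k (n + 1) k (by omega)
    have key : wzG n k + wzF (n + 1) k - wzF n k = wzG n (k + 1) := by
      obtain ⟨j, rfl⟩ := Nat.exists_eq_add_of_lt (show k < n by omega)
      have e1 : k + j + 1 - k - 1 = j := by omega
      have e2 : k + j + 1 - k = j + 1 := by omega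
      have e3 : k + j + 1 - (k + 1) = j := by omega
      have e4 : k + j + 1 + 1 - k - 1 = j + 1 := by omega
      have e5 : k + j + 1 + 1 + k + 1 = (k + j + 1 + k + 1) + 1 := by omega
      have e6 : k + j + 1 + (k + 1) + 1 = (k + j + 1 + k + 1) + 1 := by omega
      unfold wzG wzF
      rw [e1, e2, e3, e4, e5, e6, Nat.factorial_succ (k + j + 1 + k + 1), Nat.factorial_succ j,
        Nat.factorial_succ k]
      have p2 : (j.factorial : ℚ) ≠ 0 := by exact_mod_cast j.factorial_ne_zero
      have p4 : ((k + j + 1 + k + 1).factorial : ℚ) ≠ 0 := by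
        exact_mod_cast (k + j + 1 + k + 1).factorial_ne_zero
      have p5 : (k : ℚ) + j + 1 + 1 ≠ 0 := by positivity
      have p6 : (k : ℚ) + j + 1 + k + 1 + 1 ≠ 0 := by positivity
      push_cast
      field_simp
      ring
    linarith

/-- `A^(d)(n) = ∑_{k=0}^n C(n,k)^d`. -/
def binomPowSum (d n : ℕ) : ℚ :=
  ∑ k ∈ Finset.range (n + 1), (n.choose k : ℚ) ^ d

/-- `B^(d)(n) = 1/(d+1) * ∑_{k=0}^n C(n,k)^d c(n,k)`. -/
def binomPowPotentialSum (d n : ℕ) : ℚ :=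
  1 / ((d : ℚ) + 1) * ∑ k ∈ Finset.range (n + 1), (n.choose k : ℚ) ^ d * wzPotential n k

/-- The sequence `u` is annihilated by the operator `∑_{i=0}^L p_i(n) N^i` of order `L` with
polynomial coefficients, where `N` is the forward shift. -/
def SatisfiesRecurrence (L : ℕ) (p : ℕ → Polynomial ℚ) (u : ℕ → ℚ) : Prop :=
  ∀ n : ℕ, ∑ i ∈ Finset.range (L + 1), (p i).eval (n : ℚ) * u (n + i) = 0

/-! Convergence: `B/A` is `1/(d+1)` times the mean of `c(n,k)` with weights `C(n,k)^d`. Summing the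
increments of `c` in `n` up to the limit `ζ(2)` gives `|c(n,k) - ζ(2)| ≤ 4 / C(n,k)` for all `k ≤ n`
(`abs_wzPotential_sub_le`). The mean error is thus at most `4 A^(d-1)/A^(d)`, and Chebyshev's sum
inequality bounds this by `4 (n+1) / 2^n`.

Recurrence: this is Fasenmyer's method. One looks for `λ_{j,l}(n)`, free of `k`, with `∑ λ_{j,l}(n)
a(n+2J-j-l, k-j) = 0` both for `a = C^d` and for `a = C^d c`. A factorial factor turns the shifted
`C^d` into polynomials in `k`. For the second relation, write the shifted potential as `c(n+2J,k)`
minus a difference; by the WZ form this difference is a finite sum of closed forms, which a second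
common factor makes polynomial. The number of linear conditions grows linearly in `J` and there are
`(J+1)²` unknowns, so large `J` leaves a nonzero solution
(`exists_relation_scaledBinom_scaledDiff`).

Multiplying by `x^k` and summing gives a recurrence for the row polynomials. It could become trivial
at `x = 1`, so a common power of `x - 1` is cancelled first (`exists_recurrence_eval_one`). The
outcome depends only on the `λ_{j,l}`, so both sequences satisfy the same recurrence. -/

/-! ### Increments of the potential in `n` -/

theorem abs_wzG_le {n N k : ℕ} (hk : k ≤ n) (hN : n ≤ N) :
    |wzG N k| ≤ 2 / ((N + 1 : ℚ) ^ 2 * (n.choose k : ℚ)) := by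
  have h1 : N.choose k * k.factorial * (N - k).factorial = N.factorial :=
    Nat.choose_mul_factorial_mul_factorial (hk.trans hN)
  have h2 : N.factorial * k.factorial ≤ (N + k).factorial :=
    Nat.le_of_dvd (Nat.factorial_pos _) (Nat.factorial_mul_factorial_dvd_factorial_add N k)
  have h3 : n.choose k ≤ N.choose k := Nat.choose_le_choose k hN
  -- `N! k! ≤ (N+k)!` supplies the factor `C(N,k)`, which is weakened to `C(n,k)` so that the bound
  -- can be summed over `N`.
  have h4 : (N + 1) * n.choose k * (k.factorial ^ 2 * (N - k).factorial)
      ≤ (N + k + 1).factorial := by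
    calc (N + 1) * n.choose k * (k.factorial ^ 2 * (N - k).factorial)
        ≤ (N + 1) * N.choose k * (k.factorial ^ 2 * (N - k).factorial) := by gcongr
      _ = (N + 1) * (N.choose k * k.factorial * (N - k).factorial * k.factorial) := by ring
      _ = (N + 1) * (N.factorial * k.factorial) := by rw [h1]
      _ ≤ (N + k + 1) * (N + k).factorial := by gcongr; omega
      _ = (N + k + 1).factorial := (Nat.factorial_succ _).symm
  have h5 : ((N : ℚ) + 1) * n.choose k * ((k.factorial : ℚ) ^ 2 * (N - k).factorial)
      ≤ (N + k + 1).factorial := by exact_mod_cast h4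
  have hc : (0 : ℚ) < n.choose k := by exact_mod_cast Nat.choose_pos hk
  have hf : (0 : ℚ) < (N + k + 1).factorial := by exact_mod_cast Nat.factorial_pos _
  have hN1 : (0 : ℚ) < N + 1 := by positivity
  have habs : |wzG N k| = 2 * ((k.factorial : ℚ) ^ 2 * (N - k).factorial)
      / ((N + 1) * (N + k + 1).factorial) := by
    unfold wzG
    rw [abs_div, abs_mul, abs_mul, abs_mul, abs_pow, abs_neg, abs_one, one_pow,
      abs_of_pos (by norm_num : (0 : ℚ) < 2), abs_of_nonneg (by positivity),
      abs_of_nonneg (by positivity), abs_of_pos (by positivity)]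
    ring
  rw [habs, div_le_div_iff₀ (by positivity) (by positivity)]
  nlinarith [mul_le_mul_of_nonneg_left h5 hN1.le]

theorem abs_wzPotential_add_sub_le {n k : ℕ} (hk : k ≤ n) (t : ℕ) :
    |wzPotential (n + t) k - wzPotential n k|
      ≤ 4 / (n.choose k : ℚ) * (1 - 1 / ((t : ℚ) + 1)) := by
  have hc : (0 : ℚ) < n.choose k := by exact_mod_cast Nat.choose_pos hk
  induction t with
  | zero => simp
  | succ t ih =>
    have h1 := abs_wzG_le hk (Nat.le_add_right n t)
    have h2 := wzPotential_sub_n (n + t) k (by omega)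
    have h3 : wzPotential (n + (t + 1)) k - wzPotential n k
        = (wzPotential (n + t) k - wzPotential n k) + wzG (n + t) k := by
      rw [← h2, ← add_assoc]; ring
    rw [h3]
    refine (abs_add_le _ _).trans ((add_le_add ih h1).trans ?_)
    -- `1/((t+1)(t+2))` telescopes; the constant doubles because `(t+1)(t+2) ≤ 2(t+1)²`.
    have h4 : 2 / ((((n + t : ℕ) : ℚ) + 1) ^ 2 * (n.choose k : ℚ))
        ≤ 4 / (n.choose k : ℚ) * (1 / ((t + 1 : ℚ) * (t + 2))) := by
      rw [div_mul_div_comm, div_le_div_iff₀ (by positivity) (by positivity)]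
      have hn : ((t : ℚ) + 1) ^ 2 ≤ (((n + t : ℕ) : ℚ) + 1) ^ 2 := by
        push_cast; gcongr; linarith [(Nat.cast_nonneg n : (0 : ℚ) ≤ n)]
      have : (t + 1 : ℚ) * (t + 2) ≤ 2 * (((n + t : ℕ) : ℚ) + 1) ^ 2 := by
        nlinarith [(Nat.cast_nonneg t : (0 : ℚ) ≤ t)]
      nlinarith [mul_le_mul_of_nonneg_right this hc.le]
    have h5 : 4 / (n.choose k : ℚ) * (1 - 1 / ((t : ℚ) + 1))
        + 4 / (n.choose k : ℚ) * (1 / ((t + 1 : ℚ) * (t + 2)))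
        = 4 / (n.choose k : ℚ) * (1 - 1 / (((t + 1 : ℕ) : ℚ) + 1)) := by
      push_cast; field_simp; ring
    linarith

/-! ### The limit of the potential -/

open Filter Topology

theorem hasSum_alternating_inv_sq :
    HasSum (fun m : ℕ => (-1 : ℝ) ^ m / ((m : ℝ) + 1) ^ 2) (Real.pi ^ 2 / 12) := by
  have h0 : HasSum (fun m : ℕ => 1 / ((m : ℝ) + 1) ^ 2) (Real.pi ^ 2 / 6) := by
    have := (hasSum_nat_add_iff' 1).2 hasSum_zeta_two
    simpa using this
  -- The terms of odd index sum to `ζ(2)/4`; flipping their sign leaves `π²/6 - 2·π²/24`.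
  have he : HasSum (fun m : ℕ => 1 / (((2 * m + 1 : ℕ) : ℝ) + 1) ^ 2) (Real.pi ^ 2 / 24) := by
    have h := h0.mul_left (1 / 4)
    rw [show (1 / 4 : ℝ) * (Real.pi ^ 2 / 6) = Real.pi ^ 2 / 24 by ring] at h
    refine (congrArg (fun f : ℕ → ℝ => HasSum f _) (funext fun m => ?_)).mpr h
    push_cast
    field_simp
    ring
  have hodd : Summable (fun m : ℕ => 1 / (((2 * m : ℕ) : ℝ) + 1) ^ 2) :=
    h0.summable.comp_injective (i := fun m : ℕ => 2 * m) (fun a b h => by simpa using h)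
  have h1 := HasSum.even_add_odd (f := fun m : ℕ => 1 / ((m : ℝ) + 1) ^ 2) hodd.hasSum he
  have hv := h1.unique h0
  have h2 : HasSum (fun m : ℕ => (-1 : ℝ) ^ (2 * m) / (((2 * m : ℕ) : ℝ) + 1) ^ 2)
      (∑' m : ℕ, 1 / (((2 * m : ℕ) : ℝ) + 1) ^ 2) := by
    refine (congrArg (fun f : ℕ → ℝ => HasSum f _) (funext fun m => ?_)).mpr hodd.hasSum
    rw [pow_mul, neg_one_sq, one_pow]
  have h3 : HasSum (fun m : ℕ => (-1 : ℝ) ^ (2 * m + 1) / (((2 * m + 1 : ℕ) : ℝ) + 1) ^ 2)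
      (-(Real.pi ^ 2 / 24)) := by
    refine (congrArg (fun f : ℕ → ℝ => HasSum f _) (funext fun m => ?_)).mpr he.neg
    rw [pow_succ, pow_mul, neg_one_sq, one_pow, one_mul, neg_div]
  have h4 := HasSum.even_add_odd
    (f := fun m : ℕ => (-1 : ℝ) ^ m / ((m : ℝ) + 1) ^ 2) h2 h3
  rwa [show (∑' m : ℕ, 1 / (((2 * m : ℕ) : ℝ) + 1) ^ 2) + -(Real.pi ^ 2 / 24)
    = Real.pi ^ 2 / 12 by linarith] at h4

theorem tendsto_wzPotential (k : ℕ) :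
    Tendsto (fun n => (wzPotential n k : ℝ)) atTop (𝓝 (Real.pi ^ 2 / 6)) := by
  have h1 : Tendsto (fun n : ℕ => 2 * ∑ m ∈ Finset.Icc 1 n, (-1 : ℝ) ^ (m - 1) / (m : ℝ) ^ 2)
      atTop (𝓝 (Real.pi ^ 2 / 6)) := by
    have := (hasSum_alternating_inv_sq.tendsto_sum_nat).const_mul 2
    rw [show (2 : ℝ) * (Real.pi ^ 2 / 12) = Real.pi ^ 2 / 6 by ring] at this
    refine this.congr fun n => ?_
    congr 1
    induction n with
    | zero => simp
    | succ n ih => rw [Finset.sum_range_succ, ih, Finset.sum_Icc_succ_top (by omega)]; simp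
  -- Since `k` is fixed, the correction has a fixed number of terms, each eventually at most
  -- `1/(n+1)`.
  have h2 : Tendsto (fun n : ℕ => ∑ m ∈ Finset.Icc 1 k,
      (-1 : ℝ) ^ (n + m - 1) / ((m : ℝ) ^ 2 * (n.choose m : ℝ) * ((n + m).choose m : ℝ)))
      atTop (𝓝 0) := by
    rw [← Finset.sum_const_zero (s := Finset.Icc 1 k)]
    refine tendsto_finsetSum _ fun m hm => ?_
    have hm1 : 1 ≤ m := (Finset.mem_Icc.1 hm).1
    refine squeeze_zero_norm' (a := fun n : ℕ => 1 / ((n : ℝ) + 1)) ?_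
      tendsto_one_div_add_atTop_nhds_zero_nat
    filter_upwards [eventually_ge_atTop m] with n hn
    have hA : (1 : ℝ) ≤ n.choose m := by exact_mod_cast Nat.choose_pos hn
    have hB : (n : ℝ) + 1 ≤ (n + m).choose m := by
      have : n + 1 ≤ (n + m).choose m := by
        calc n + 1 = (n + 1).choose n := by simp
          _ ≤ (n + m).choose n := Nat.choose_le_choose n (by omega)
          _ = (n + m).choose m := Nat.choose_symm_add
      exact_mod_cast this
    have hM : (1 : ℝ) ≤ (m : ℝ) ^ 2 := by
      have : (1 : ℝ) ≤ m := by exact_mod_cast hm1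
      nlinarith
    rw [norm_div, norm_pow, norm_neg, norm_one, one_pow, Real.norm_of_nonneg (by positivity)]
    apply one_div_le_one_div_of_le (by positivity)
    have : (1 : ℝ) ≤ (m : ℝ) ^ 2 * n.choose m := by nlinarith
    nlinarith [(Nat.cast_nonneg n : (0 : ℝ) ≤ n)]
  have := h1.add h2
  rw [add_zero] at this
  refine this.congr fun n => ?_
  unfold wzPotential
  push_cast
  rfl

theorem abs_wzPotential_sub_le {n k : ℕ} (hk : k ≤ n) :
    |(wzPotential n k : ℝ) - Real.pi ^ 2 / 6| ≤ 4 / (n.choose k : ℝ) := by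
  have ht : Tendsto (fun t : ℕ => |(wzPotential (n + t) k : ℝ) - wzPotential n k|) atTop
      (𝓝 |Real.pi ^ 2 / 6 - wzPotential n k|) :=
    (((tendsto_wzPotential k).comp (tendsto_add_atTop_nat n)).sub_const _ |>.abs).congr
      fun t => by simp [add_comm]
  rw [abs_sub_comm]
  refine le_of_tendsto' ht fun t => ?_
  have h1 := abs_wzPotential_add_sub_le hk t
  have hc : (0 : ℚ) < n.choose k := by exact_mod_cast Nat.choose_pos hk
  have h2 : 4 / (n.choose k : ℚ) * (1 - 1 / ((t : ℚ) + 1)) ≤ 4 / (n.choose k : ℚ) := by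
    have : (0 : ℚ) ≤ 1 / ((t : ℚ) + 1) := by positivity
    have h4 : (0 : ℚ) < 4 / (n.choose k : ℚ) := by positivity
    nlinarith
  have h3 : ((|wzPotential (n + t) k - wzPotential n k| : ℚ) : ℝ) ≤ (4 / (n.choose k : ℚ) : ℚ) :=
    Rat.cast_le.2 (h1.trans h2)
  push_cast at h3
  exact h3

/-! ### Weighted means and the exponential rate -/

theorem binomPowSum_pos (d n : ℕ) : 0 < binomPowSum d n := by
  unfold binomPowSum
  refine Finset.sum_pos (fun k hk => ?_) (by simp)
  have : 0 < n.choose k := Nat.choose_pos (by simpa [Nat.lt_succ_iff] using hk)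
  positivity

/-- Chebyshev's sum inequality for powers of binomial coefficients. -/
theorem two_pow_mul_binomPowSum_le (d n : ℕ) :
    2 ^ n * binomPowSum d n ≤ (n + 1) * binomPowSum (d + 1) n := by
  have hmono : Monovary (fun k : ℕ => (n.choose k : ℚ)) (fun k : ℕ => (n.choose k : ℚ) ^ d) := by
    intro a b hab
    by_contra! h
    exact absurd hab (not_lt.2 (pow_le_pow_left₀ (by positivity) h.le d))
  have h := (hmono.monovaryOn (Finset.range (n + 1) : Set ℕ)).sum_mul_sum_le_card_mul_sum
  have h2 : ∑ k ∈ Finset.range (n + 1), (n.choose k : ℚ) = 2 ^ n := by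
    exact_mod_cast Nat.sum_range_choose n
  rw [h2, Finset.card_range] at h
  unfold binomPowSum
  push_cast at h
  simpa [pow_succ'] using h

theorem abs_potential_ratio_sub_le (d n : ℕ) :
    |((binomPowPotentialSum (d + 1) n / binomPowSum (d + 1) n : ℚ) : ℝ)
      - Real.pi ^ 2 / 6 / ((d + 1 : ℕ) + 1)| ≤ 12 / (3 / 2) ^ n := by
  have hA := binomPowSum_pos (d + 1) n
  have hAR : (0 : ℝ) < binomPowSum (d + 1) n := by exact_mod_cast hA
  have hnum : |∑ k ∈ Finset.range (n + 1), (n.choose k : ℝ) ^ (d + 1)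
      * ((wzPotential n k : ℝ) - Real.pi ^ 2 / 6)| ≤ 4 * (binomPowSum d n : ℝ) := by
    refine (Finset.abs_sum_le_sum_abs _ _).trans ?_
    unfold binomPowSum
    push_cast
    rw [Finset.mul_sum]
    refine Finset.sum_le_sum fun k hk => ?_
    have hk' : k ≤ n := by simpa [Nat.lt_succ_iff] using hk
    have hc : (0 : ℝ) < n.choose k := by exact_mod_cast Nat.choose_pos hk'
    rw [abs_mul, abs_of_pos (by positivity)]
    calc (n.choose k : ℝ) ^ (d + 1) * |(wzPotential n k : ℝ) - Real.pi ^ 2 / 6|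
        ≤ (n.choose k : ℝ) ^ (d + 1) * (4 / (n.choose k : ℝ)) := by
          gcongr; exact abs_wzPotential_sub_le hk'
      _ = 4 * (n.choose k : ℝ) ^ d := by field_simp; ring
  have heq : ((binomPowPotentialSum (d + 1) n / binomPowSum (d + 1) n : ℚ) : ℝ)
      - Real.pi ^ 2 / 6 / ((d + 1 : ℕ) + 1)
      = (∑ k ∈ Finset.range (n + 1), (n.choose k : ℝ) ^ (d + 1)
      * ((wzPotential n k : ℝ) - Real.pi ^ 2 / 6)) / ((((d + 1 : ℕ) : ℝ) + 1) * (binomPowSum (d + 1) n : ℝ)) := by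
    simp only [mul_sub, Finset.sum_sub_distrib, ← Finset.sum_mul]
    have : ∑ k ∈ Finset.range (n + 1), (n.choose k : ℝ) ^ (d + 1) = binomPowSum (d + 1) n := by
      unfold binomPowSum; push_cast; rfl
    rw [this]
    have h2 : (binomPowPotentialSum (d + 1) n : ℝ) = 1 / ((d + 1 : ℕ) + 1)
        * ∑ k ∈ Finset.range (n + 1), (n.choose k : ℝ) ^ (d + 1) * (wzPotential n k : ℝ) := by
      unfold binomPowPotentialSum; push_cast; rfl
    rw [Rat.cast_div, h2]
    field_simp
  rw [heq, abs_div, abs_of_pos (by positivity : (0 : ℝ) < (((d + 1 : ℕ) : ℝ) + 1) * (binomPowSum (d + 1) n : ℝ)),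
    div_le_div_iff₀ (by positivity) (by positivity)]
  have hch : (2 : ℝ) ^ n * binomPowSum d n ≤ (n + 1) * binomPowSum (d + 1) n := by
    exact_mod_cast two_pow_mul_binomPowSum_le d n
  -- Bernoulli absorbs the factor `n+1` at the price of lowering the rate from `2` to `2/(4/3) =
  -- 3/2`; the constant is `4·3 = 12`.
  have hbern : ((n : ℝ) + 1) ≤ 3 * (4 / 3) ^ n := by
    have := one_add_mul_le_pow (show (-2 : ℝ) ≤ 1 / 3 by norm_num) n
    have e : (1 : ℝ) + 1 / 3 = 4 / 3 := by norm_num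
    rw [e] at this
    linarith
  have e2 : (3 / 2 : ℝ) ^ n * (4 / 3) ^ n = 2 ^ n := by rw [← mul_pow]; norm_num
  have hAd : (0 : ℝ) ≤ binomPowSum d n := by exact_mod_cast (binomPowSum_pos d n).le
  have h43 : (0 : ℝ) < (4 / 3 : ℝ) ^ n := by positivity
  have key : (3 / 2 : ℝ) ^ n * binomPowSum d n ≤ 3 * binomPowSum (d + 1) n := by
    have : (4 / 3 : ℝ) ^ n * ((3 / 2 : ℝ) ^ n * binomPowSum d n)
        ≤ (4 / 3 : ℝ) ^ n * (3 * binomPowSum (d + 1) n) := by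
      calc (4 / 3 : ℝ) ^ n * ((3 / 2 : ℝ) ^ n * binomPowSum d n)
          = 2 ^ n * binomPowSum d n := by rw [← e2]; ring
        _ ≤ (n + 1) * binomPowSum (d + 1) n := hch
        _ ≤ 3 * (4 / 3) ^ n * binomPowSum (d + 1) n := by gcongr
        _ = _ := by ring
    exact le_of_mul_le_mul_left this h43
  have hd1 : (1 : ℝ) ≤ (d + 1 : ℕ) + 1 := by push_cast; linarith [(Nat.cast_nonneg d : (0 : ℝ) ≤ d)]
  calc _ ≤ 4 * (binomPowSum d n : ℝ) * (3 / 2) ^ n := by gcongr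
    _ ≤ 12 * (1 * binomPowSum (d + 1) n) := by linarith
    _ ≤ _ := by gcongr

theorem norm_potential_ratio_sub_zeta_le (d n : ℕ) (hd : d ≠ 0) :
    ‖((binomPowPotentialSum d n / binomPowSum d n : ℚ) : ℂ) - riemannZeta 2 / ((d : ℂ) + 1)‖
      ≤ 12 / (3 / 2) ^ n := by
  obtain ⟨e, rfl⟩ := Nat.exists_eq_succ_of_ne_zero hd
  have h : ((binomPowPotentialSum (e + 1) n / binomPowSum (e + 1) n : ℚ) : ℂ)
      - riemannZeta 2 / (((e + 1 : ℕ) : ℂ) + 1)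
      = (((binomPowPotentialSum (e + 1) n / binomPowSum (e + 1) n : ℚ) : ℝ)
      - Real.pi ^ 2 / 6 / ((e + 1 : ℕ) + 1) : ℝ) := by
    rw [riemannZeta_two]; push_cast; rfl
  rw [Nat.succ_eq_add_one, h, Complex.norm_real]
  exact abs_potential_ratio_sub_le e n

/-! ### Specializing recurrences at `x = 1` -/

open Polynomial in
-- While all the polynomials vanish at `1`, divide all of them by `X - 1`; the degree of one fixed
-- nonzero member drops, so this stops.
theorem exists_eq_X_sub_one_pow_mul {R : Type*} [CommRing R] [IsDomain R] (M : ℕ)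
    (Q : ℕ → R[X]) (hQ : ∃ i ≤ M, Q i ≠ 0) :
    ∃ (r : ℕ) (q : ℕ → R[X]), (∀ i ≤ M, Q i = (X - C 1) ^ r * q i) ∧
      ∃ i ≤ M, (q i).eval 1 ≠ 0 := by
  obtain ⟨a, ha, hQa⟩ := hQ
  induction hN : (Q a).natDegree using Nat.strong_induction_on generalizing Q with
  | _ N ih =>
    by_cases h : ∃ i ≤ M, (Q i).eval 1 ≠ 0
    · exact ⟨0, Q, by simp, h⟩
    · push Not at h
      have hdvd : ∀ i, ∃ g, i ≤ M → Q i = (X - C 1) * g := by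
        intro i
        by_cases hi : i ≤ M
        · obtain ⟨g, hg⟩ := dvd_iff_isRoot.2 (h i hi)
          exact ⟨g, fun _ => hg⟩
        · exact ⟨0, fun h => absurd h hi⟩
      choose g hg using hdvd
      have hga : g a ≠ 0 := by
        intro h0
        exact hQa (by rw [hg a ha, h0, mul_zero])
      have hdeg : (g a).natDegree < N := by
        rw [← hN, hg a ha, natDegree_mul (X_sub_C_ne_zero 1) hga, natDegree_X_sub_C]
        omega
      obtain ⟨r, q, h1, h2⟩ := ih _ hdeg g hga rfl
      refine ⟨r + 1, q, fun i hi => ?_, h2⟩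
      rw [hg i hi, h1 i hi, pow_succ']
      ring

open Polynomial in
theorem exists_forall_eval_natCast_add_ne_zero (g : ℚ[X]) (hg : g ≠ 0) :
    ∃ s : ℕ, ∀ n : ℕ, g.eval ((n : ℚ) + s) ≠ 0 := by
  have hfin : {n : ℕ | g.eval (n : ℚ) = 0}.Finite := by
    refine ((g.rootSet_finite ℚ).preimage (f := fun n : ℕ => (n : ℚ))
      (Nat.cast_injective.injOn)).subset fun n hn => ?_
    simp only [Set.mem_preimage, mem_rootSet]
    exact ⟨hg, by simpa using hn⟩
  obtain ⟨b, hb⟩ := hfin.bddAbove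
  refine ⟨b + 1, fun n h => ?_⟩
  have := hb (show n + (b + 1) ∈ {n : ℕ | g.eval (n : ℚ) = 0} by
    exact_mod_cast h)
  omega

open Polynomial in
/-- Composing a recurrence with a shift removes the nonnegative integer zeros of its leading
coefficient. -/
theorem exists_recurrence_leading_ne_zero (M : ℕ) (g : ℕ → ℚ[X]) (hg : ∃ i ≤ M, g i ≠ 0) :
    ∃ (L : ℕ) (p : ℕ → ℚ[X]), (∀ n : ℕ, (p L).eval (n : ℚ) ≠ 0) ∧
      ∀ u : ℕ → ℚ, SatisfiesRecurrence M g u → SatisfiesRecurrence L p u := by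
  classical
  obtain ⟨a, ha, hga⟩ := hg
  -- All coefficients above `b` vanish, so `b` is the true order; `s` then moves past the roots of
  -- `g b`.
  set b := Nat.findGreatest (fun i => g i ≠ 0) M with hb
  have hgb : g b ≠ 0 := Nat.findGreatest_spec (P := fun i => g i ≠ 0) ha hga
  have hbM : b ≤ M := Nat.findGreatest_le M
  obtain ⟨s, hs⟩ := exists_forall_eval_natCast_add_ne_zero (g b) hgb
  refine ⟨s + b, fun j => if j < s then 0 else (g (j - s)).comp (X + C (s : ℚ)), ?_, ?_⟩
  · intro n
    simpa using hs n
  · intro u hu n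
    rw [add_assoc, Finset.sum_range_add, Finset.sum_eq_zero, zero_add]
    · rw [← hu (n + s)]
      have hsub : Finset.range (b + 1) ⊆ Finset.range (M + 1) :=
        Finset.range_subset_range.2 (by omega)
      rw [← Finset.sum_subset hsub]
      · refine Finset.sum_congr rfl fun i _ => ?_
        simp [add_assoc]
      · intro i hi hi'
        have h0 : g i = 0 := by
          by_contra h
          exact hi' (Finset.mem_range.2 (Nat.lt_succ_of_le
            (Nat.le_findGreatest (P := fun i => g i ≠ 0) (Nat.lt_succ_iff.1 (Finset.mem_range.1 hi)) h)))
        simp [h0]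
    · intro j hj
      simp [Finset.mem_range.1 hj]

open Polynomial in
/-- A recurrence with coefficients in `ℚ[n][x]` for polynomials in `x` specializes to a nontrivial
recurrence for their values at `x = 1`. -/
theorem exists_recurrence_eval_one (M : ℕ) (Q : ℕ → ℚ[X][X]) (hQ : ∃ i ≤ M, Q i ≠ 0) :
    ∃ (L : ℕ) (p : ℕ → ℚ[X]), (∀ n : ℕ, (p L).eval (n : ℚ) ≠ 0) ∧
      ∀ f : ℕ → ℚ[X], (∀ n : ℕ, ∑ i ∈ Finset.range (M + 1),
        (Q i).map (evalRingHom (n : ℚ)) * f (n + i) = 0) →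
        SatisfiesRecurrence L p (fun n => (f n).eval 1) := by
  obtain ⟨r, q, hq, hne⟩ := exists_eq_X_sub_one_pow_mul M Q hQ
  obtain ⟨L, p, hp, hrec⟩ := exists_recurrence_leading_ne_zero M (fun i => (q i).eval 1) hne
  refine ⟨L, p, hp, fun f hf => hrec _ fun n => ?_⟩
  have h1 : (X - C 1 : ℚ[X]) ^ r * ∑ i ∈ Finset.range (M + 1),
      (q i).map (evalRingHom (n : ℚ)) * f (n + i) = 0 := by
    rw [← hf n, Finset.mul_sum]
    refine Finset.sum_congr rfl fun i hi => ?_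
    rw [hq i (Nat.lt_succ_iff.1 (Finset.mem_range.1 hi))]
    simp [mul_assoc]
  have h2 := (mul_eq_zero.1 h1).resolve_left (pow_ne_zero _ (X_sub_C_ne_zero 1))
  have h3 := congrArg (eval 1) h2
  rw [eval_finsetSum, eval_zero] at h3
  rw [← h3]
  refine Finset.sum_congr rfl fun i _ => ?_
  rw [eval_mul]
  congr 1
  simp

/-! ### Linear algebra over the coefficient ring -/

open Polynomial in
-- Two relations in degree at most `D` impose `2(D+1)` linear conditions on the coefficients. The
-- rank bound holds over any nontrivial commutative ring, so for `R = ℚ[n]` no denominators need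
-- clearing.
theorem exists_nontrivial_relation_of_natDegree_le {ι R : Type*} [Fintype ι] [CommRing R]
    [Nontrivial R] (D : ℕ) (P S : ι → R[X]) (hP : ∀ i, (P i).natDegree ≤ D)
    (hS : ∀ i, (S i).natDegree ≤ D) (hcard : 2 * (D + 1) < Fintype.card ι) :
    ∃ c : ι → R, (∃ i, c i ≠ 0) ∧ ∑ i, C (c i) * P i = 0 ∧ ∑ i, C (c i) * S i = 0 := by
  let v : ι → (Fin (D + 1) ⊕ Fin (D + 1) → R) := fun i =>
    Sum.elim (fun a => (P i).coeff a) (fun a => (S i).coeff a)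
  have hv : ¬ LinearIndependent R v := by
    intro h
    have := h.fintype_card_le_finrank
    simp at this
    omega
  obtain ⟨c, hc, hne⟩ := Fintype.not_linearIndependent_iff.1 hv
  refine ⟨c, hne, ?_, ?_⟩
  · ext a
    by_cases ha : a < D + 1
    · simpa [v, finsetSum_coeff] using congrFun hc (Sum.inl ⟨a, ha⟩)
    · simp only [finsetSum_coeff, coeff_C_mul, coeff_zero]
      refine Finset.sum_eq_zero fun i _ => ?_
      rw [coeff_eq_zero_of_natDegree_lt (by have := hP i; omega), mul_zero]
  · ext a
    by_cases ha : a < D + 1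
    · simpa [v, finsetSum_coeff] using congrFun hc (Sum.inr ⟨a, ha⟩)
    · simp only [finsetSum_coeff, coeff_C_mul, coeff_zero]
      refine Finset.sum_eq_zero fun i _ => ?_
      rw [coeff_eq_zero_of_natDegree_lt (by have := hS i; omega), mul_zero]

/-! ### Polynomial functions of `n` and `k` with bounded degree in `k` -/

open Polynomial in
/-- `f n k` is a polynomial in `n` and `k`, of degree at most `D` in `k`. -/
def IsPolyOfDegreeLE (D : ℕ) (f : ℕ → ℕ → ℚ) : Prop :=
  ∃ P : ℚ[X][X], P.natDegree ≤ D ∧ ∀ n k : ℕ, f n k = (P.eval (C (k : ℚ))).eval (n : ℚ)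

namespace IsPolyOfDegreeLE

open Polynomial

variable {D E : ℕ} {f g : ℕ → ℕ → ℚ}

theorem mono (hf : IsPolyOfDegreeLE D f) (h : D ≤ E) : IsPolyOfDegreeLE E f := by
  obtain ⟨P, hP, h1⟩ := hf
  exact ⟨P, hP.trans h, h1⟩

theorem of_polynomial (p : ℚ[X]) : IsPolyOfDegreeLE 0 (fun n _ => p.eval (n : ℚ)) :=
  ⟨C p, by simp, by simp⟩

theorem const (a : ℚ) : IsPolyOfDegreeLE 0 (fun _ _ => a) :=
  ⟨C (C a), by simp, by simp⟩

theorem fst : IsPolyOfDegreeLE 0 (fun n _ => (n : ℚ)) :=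
  ⟨C X, by simp, by simp⟩

theorem snd : IsPolyOfDegreeLE 1 (fun _ k => (k : ℚ)) :=
  ⟨X, by simp, by simp⟩

theorem mul (hf : IsPolyOfDegreeLE D f) (hg : IsPolyOfDegreeLE E g) :
    IsPolyOfDegreeLE (D + E) (fun n k => f n k * g n k) := by
  obtain ⟨P, hP, h1⟩ := hf
  obtain ⟨Q, hQ, h2⟩ := hg
  exact ⟨P * Q, natDegree_mul_le.trans (add_le_add hP hQ), by simp [h1, h2]⟩

theorem add (hf : IsPolyOfDegreeLE D f) (hg : IsPolyOfDegreeLE D g) :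
    IsPolyOfDegreeLE D (fun n k => f n k + g n k) := by
  obtain ⟨P, hP, h1⟩ := hf
  obtain ⟨Q, hQ, h2⟩ := hg
  exact ⟨P + Q, natDegree_add_le_of_degree_le hP hQ, by simp [h1, h2]⟩

theorem sub (hf : IsPolyOfDegreeLE D f) (hg : IsPolyOfDegreeLE D g) :
    IsPolyOfDegreeLE D (fun n k => f n k - g n k) := by
  simpa [sub_eq_add_neg] using hf.add ((const (-1)).mul hg |>.mono (by omega))

theorem pow (hf : IsPolyOfDegreeLE D f) (m : ℕ) :
    IsPolyOfDegreeLE (m * D) (fun n k => f n k ^ m) := by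
  obtain ⟨P, hP, h1⟩ := hf
  exact ⟨P ^ m, natDegree_pow_le_of_le m hP, by simp [h1]⟩

theorem sum {ι : Type*} (s : Finset ι) {F : ι → ℕ → ℕ → ℚ}
    (hF : ∀ i ∈ s, IsPolyOfDegreeLE D (F i)) :
    IsPolyOfDegreeLE D (fun n k => ∑ i ∈ s, F i n k) := by
  classical
  induction s using Finset.induction_on with
  | empty => simpa using (const 0).mono (Nat.zero_le D)
  | insert a s ha ih =>
    simp only [Finset.sum_insert ha]
    exact (hF a (by simp)).add (ih fun i hi => hF i (by simp [hi]))

theorem eval (hf : IsPolyOfDegreeLE D f) (q : ℚ[X]) :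
    IsPolyOfDegreeLE (q.natDegree * D) (fun n k => q.eval (f n k)) := by
  obtain ⟨P, hP, h1⟩ := hf
  refine ⟨(q.map C).comp P, natDegree_comp_le.trans
    (Nat.mul_le_mul (natDegree_map_le) hP), fun n k => ?_⟩
  simp only [h1, eval_comp, eval_map]
  have h := Polynomial.hom_eval₂ q C (evalRingHom (n : ℚ)) (P.eval (C (k : ℚ)))
  rw [show (evalRingHom (n : ℚ)).comp C = RingHom.id ℚ from RingHom.ext fun x => by simp] at h
  exact h.symm

theorem descPochhammer (hf : IsPolyOfDegreeLE 1 f) (j : ℕ) :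
    IsPolyOfDegreeLE j (fun n k => (descPochhammer ℚ j).eval (f n k)) := by
  simpa [descPochhammer_natDegree] using hf.eval (_root_.descPochhammer ℚ j)

end IsPolyOfDegreeLE

/-! ### Scaled binomials and scaled increments of the potential -/

theorem descPochhammer_eval_natCast_add (a t : ℕ) :
    (descPochhammer ℚ t).eval ((a : ℚ) + t) = ((a + t).factorial : ℚ) / a.factorial := by
  have h : (a.factorial : ℚ) * (a + t).descFactorial t = (a + t).factorial := by
    exact_mod_cast by simpa using Nat.factorial_mul_descFactorial (show t ≤ a + t by omega)
  rw [← Nat.cast_add, descPochhammer_eval_eq_descFactorial, ← h]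
  field_simp

/-- `∏_{a<r} (n+a+1)`. -/
def shiftedProd (r n : ℕ) : ℚ := ∏ a ∈ Finset.range r, ((n : ℚ) + a + 1)

theorem shiftedProd_ne_zero (r n : ℕ) : shiftedProd r n ≠ 0 :=
  Finset.prod_ne_zero_iff.2 fun a _ => by positivity

open Polynomial in
theorem isPolyOfDegreeLE_shiftedProd_div {r a : ℕ} (ha : a < r) :
    IsPolyOfDegreeLE 0 (fun n _ => shiftedProd r n / ((n : ℚ) + a + 1)) := by
  convert IsPolyOfDegreeLE.of_polynomial
    (∏ b ∈ (Finset.range r).erase a, (X + C (b : ℚ) + 1)) using 3 with n k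
  have h := Finset.mul_prod_erase (Finset.range r) (fun b : ℕ => (n : ℚ) + b + 1)
    (Finset.mem_range.2 ha)
  have h0 : (n : ℚ) + a + 1 ≠ 0 := by positivity
  rw [shiftedProd, ← h, eval_prod, mul_div_assoc, mul_comm, div_mul_cancel₀ _ h0]
  simp

/-- `C(n+2J-j-l, k-j)` times `k! (n+2J-k)! / n!`, as a polynomial. -/
noncomputable def scaledBinom (J j l n k : ℕ) : ℚ :=
  ((n + 1).ascFactorial (2 * J - j - l) : ℚ) * (descPochhammer ℚ j).eval (k : ℚ)
    * (descPochhammer ℚ l).eval ((n : ℚ) + 2 * J - k)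

theorem scaledBinom_eq_zero {J j l n k : ℕ} (hk : k ≤ n + 2 * J)
    (h : ¬ (j ≤ k ∧ l ≤ n + 2 * J - k)) : scaledBinom J j l n k = 0 := by
  have hw : (n : ℚ) + 2 * J - k = ((n + 2 * J - k : ℕ) : ℚ) := by push_cast [hk]; ring
  unfold scaledBinom
  rw [hw]
  by_cases hj : j ≤ k
  · rw [descPochhammer_eval_coe_nat_of_lt (show n + 2 * J - k < l by omega), mul_zero]
  · rw [descPochhammer_eval_coe_nat_of_lt (show k < j by omega), mul_zero, zero_mul]

theorem scaledBinom_eq {J j l n u w : ℕ} (h : n + 2 * J = u + j + (w + l)) (hjl : j + l ≤ 2 * J) :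
    ((u + j).factorial : ℚ) * (w + l).factorial / n.factorial * (u + w).choose u
      = scaledBinom J j l n (u + j) := by
  have hw : (n : ℚ) + 2 * J - (u + j : ℕ) = (w : ℚ) + l := by
    have : (n : ℚ) + 2 * J = u + j + (w + l) := by exact_mod_cast h
    push_cast; linarith
  have ha : (n.factorial : ℚ) * (n + 1).ascFactorial (2 * J - j - l) = (u + w).factorial := by
    rw [show u + w = n + (2 * J - j - l) by omega]
    exact_mod_cast Nat.factorial_mul_ascFactorial n (2 * J - j - l)
  have hc : ((u + w).choose u : ℚ) * u.factorial * w.factorial = (u + w).factorial := by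
    rw [← Nat.add_choose_mul_factorial_mul_factorial u w, Nat.choose_symm_add]
    push_cast
    ring
  unfold scaledBinom
  rw [hw, Nat.cast_add, descPochhammer_eval_natCast_add, descPochhammer_eval_natCast_add]
  field_simp
  rw [ha, ← hc]

/-- A diagonal step is a step in `n` followed by one in `k`; here `w = n - k` stays fixed. -/
theorem wzPotential_add_one_add_one_sub (u w : ℕ) :
    wzPotential (u + 1 + w) (u + 1) - wzPotential (u + w) u
      = (-1) ^ w * (u.factorial : ℚ) ^ 2 * w.factorial * (3 * u + w + 3)
        / (((u : ℚ) + w + 1) * (2 * u + w + 2).factorial) := by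
  have h1 := wzPotential_sub_n (u + w) u (by omega)
  have h2 := wzPotential_sub_k (u + 1 + w) u (by omega)
  rw [show u + w + 1 = u + 1 + w by omega] at h1
  have h3 : wzPotential (u + 1 + w) (u + 1) - wzPotential (u + w) u
      = wzF (u + 1 + w) u + wzG (u + w) u := by linarith
  rw [h3]
  unfold wzF wzG
  rw [show u + 1 + w - u - 1 = w by omega, show u + w - u = w by omega,
    show u + 1 + w + u + 1 = 2 * u + w + 1 + 1 by omega, show u + w + u + 1 = 2 * u + w + 1 by omega,
    show u + 1 + w + u = 2 * u + (w + 1) by omega, show u + w + u = 2 * u + w by omega,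
    Nat.factorial_succ (2 * u + w + 1), pow_add, pow_add _ (2 * u) w, pow_mul, neg_one_sq, one_pow,
    pow_succ]
  push_cast
  field_simp
  ring

theorem wzPotential_add_one_sub (u w : ℕ) :
    wzPotential (u + (w + 1)) u - wzPotential (u + w) u
      = 2 * (-1) ^ w * (u.factorial : ℚ) ^ 2 * w.factorial
        / (((u : ℚ) + w + 1) * (2 * u + w + 1).factorial) := by
  rw [← add_assoc, wzPotential_sub_n (u + w) u (by omega)]
  unfold wzG
  rw [show u + w - u = w by omega, show u + w + u + 1 = 2 * u + w + 1 by omega,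
    show u + w + u = 2 * u + w by omega, pow_add, pow_mul, neg_one_sq, one_pow]
  push_cast
  ring

/-- The path takes `j` diagonal steps and then `l` steps in `n`, so each increment has a closed form
and `k ≤ n` holds throughout. -/
theorem wzPotential_add_add_sub (u w j l : ℕ) :
    wzPotential (u + j + (w + l)) (u + j) - wzPotential (u + w) u
      = ∑ t ∈ Finset.range j, (wzPotential (u + t + 1 + w) (u + t + 1)
          - wzPotential (u + t + w) (u + t))
        + ∑ t ∈ Finset.range l, (wzPotential (u + j + (w + t + 1)) (u + j)
          - wzPotential (u + j + (w + t)) (u + j)) := by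
  have h1 := Finset.sum_range_sub (fun t => wzPotential (u + t + w) (u + t)) j
  have h2 := Finset.sum_range_sub (fun t => wzPotential (u + j + (w + t)) (u + j)) l
  simp only [add_zero, ← add_assoc] at h1 h2 ⊢
  rw [h1, h2]
  ring

/-- The factor that clears the denominators of the increments of the potential. -/
def potentialScale (J n k : ℕ) : ℚ :=
  (-1) ^ (n + 2 * J - k) * ((n + 2 * J + k).factorial : ℚ) * shiftedProd (2 * J) n
    / ((k.factorial : ℚ) ^ 2 * (n + 2 * J - k).factorial)

theorem potentialScale_ne_zero (J n k : ℕ) : potentialScale J n k ≠ 0 := by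
  unfold potentialScale
  have := shiftedProd_ne_zero (2 * J) n
  positivity

/-- Scaled increment of the potential along a diagonal step. -/
noncomputable def diagTerm (e J j l t n k : ℕ) : ℚ :=
  ((n + 1).ascFactorial (2 * J - j - l) : ℚ) ^ (e + 3)
    * (descPochhammer ℚ j).eval (k : ℚ) ^ (e + 1)
    * (descPochhammer ℚ l).eval ((n : ℚ) + 2 * J - k) ^ (e + 2)
    * ((-1) ^ l * (descPochhammer ℚ t).eval ((k : ℚ) - j + t) ^ 2
      * (3 * ((k : ℚ) - j + t) + ((n : ℚ) + 2 * J - k - l) + 3)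
      * (descPochhammer ℚ (2 * (j - t - 1) + l)).eval ((n : ℚ) + 2 * J + k)
      * (shiftedProd (2 * J) n / ((n : ℚ) + (2 * J - j - l + t : ℕ) + 1)))

/-- Scaled increment of the potential along a step in `n`. -/
noncomputable def rowTerm (e J j l t n k : ℕ) : ℚ :=
  ((n + 1).ascFactorial (2 * J - j - l) : ℚ) ^ (e + 3)
    * (descPochhammer ℚ j).eval (k : ℚ) ^ (e + 3)
    * (descPochhammer ℚ l).eval ((n : ℚ) + 2 * J - k) ^ (e + 2)
    * (2 * (-1) ^ (l + t) * (descPochhammer ℚ t).eval ((n : ℚ) + 2 * J - k - l + t)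
      * (descPochhammer ℚ (l - t - 1)).eval ((n : ℚ) + 2 * J + k)
      * (shiftedProd (2 * J) n / ((n : ℚ) + (2 * J - l + t : ℕ) + 1)))

/-- Scaled difference of the potentials at `(n+2J, k)` and `(n+2J-j-l, k-j)`. -/
noncomputable def scaledDiff (e J j l n k : ℕ) : ℚ :=
  ∑ t ∈ Finset.range j, diagTerm e J j l t n k + ∑ t ∈ Finset.range l, rowTerm e J j l t n k

/-- Outside the triangle a falling factorial vanishes. For `k < j` this needs the exponent `e + 1 =
d - 2` in `diagTerm` to be positive, which is where `d ≥ 3` enters. -/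
theorem scaledDiff_eq_zero {e J j l n k : ℕ} (hk : k ≤ n + 2 * J)
    (h : ¬ (j ≤ k ∧ l ≤ n + 2 * J - k)) : scaledDiff e J j l n k = 0 := by
  have hw : (n : ℚ) + 2 * J - k = ((n + 2 * J - k : ℕ) : ℚ) := by push_cast [hk]; ring
  unfold scaledDiff diagTerm rowTerm
  rw [hw]
  by_cases hj : j ≤ k
  · simp [descPochhammer_eval_coe_nat_of_lt (show n + 2 * J - k < l by omega)]
  · simp [descPochhammer_eval_coe_nat_of_lt (show k < j by omega)]

/-- The increment carries `(u+t)!² w!` and the scale divides by `(u+j)!² (w+l)!`; this uses up two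
of the `e+3` factors `(u+j)!/u!` and one of the factors `(w+l)!/w!`. -/
theorem diagTerm_eq {e J j l t n u w : ℕ} (h : n + 2 * J = u + j + (w + l)) (ht : t < j)
    (hjl : j + l ≤ 2 * J) :
    scaledBinom J j l n (u + j) ^ (e + 3) * potentialScale J n (u + j)
      * (wzPotential (u + t + 1 + w) (u + t + 1) - wzPotential (u + t + w) (u + t))
      = diagTerm e J j l t n (u + j) := by
  have hq : (n : ℚ) + 2 * J = u + j + (w + l) := by exact_mod_cast h
  have hs : n + 2 * J - (u + j) = w + l := by omega
  have h1 : (n : ℚ) + 2 * J - (u + j : ℕ) = (w : ℚ) + l := by push_cast; linarith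
  have h2 : ((u + j : ℕ) : ℚ) - j + t = (u : ℚ) + t := by push_cast; ring
  have h3 : (n : ℚ) + 2 * J + (u + j : ℕ)
      = ((2 * (u + t) + w + 2 : ℕ) : ℚ) + (2 * (j - t - 1) + l : ℕ) := by
    have : n + 2 * J + (u + j) = (2 * (u + t) + w + 2) + (2 * (j - t - 1) + l) := by omega
    exact_mod_cast this
  have h4 : n + 2 * J + (u + j) = (2 * (u + t) + w + 2) + (2 * (j - t - 1) + l) := by omega
  have h5 : (n : ℚ) + (2 * J - j - l + t : ℕ) + 1 = (u + t : ℕ) + w + 1 := by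
    have : n + (2 * J - j - l + t) = u + t + w := by omega
    exact_mod_cast congrArg (· + 1) this
  have h6 : ((u + t : ℕ) : ℚ) + w + 1 ≠ 0 := by positivity
  have h7 : ((-1 : ℚ) ^ w) * (-1) ^ w = 1 := by rw [← mul_pow]; norm_num
  rw [wzPotential_add_one_add_one_sub]
  unfold diagTerm scaledBinom potentialScale
  rw [h5, h3, h2, h1, h4, hs, descPochhammer_eval_natCast_add, descPochhammer_eval_natCast_add,
    Nat.cast_add u j, descPochhammer_eval_natCast_add, descPochhammer_eval_natCast_add,
    add_sub_cancel_right, mul_pow, mul_pow, pow_add _ w l,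
    show e + 3 = e + 1 + 2 from rfl, pow_add (_ / _) (e + 1) 2,
    show e + 1 + 2 = e + 2 + 1 from rfl, pow_succ (_ / (w.factorial : ℚ)) (e + 2)]
  generalize ((u + j).factorial / u.factorial : ℚ) ^ (e + 1) = A
  generalize ((w + l).factorial / w.factorial : ℚ) ^ (e + 2) = B
  generalize ((n + 1).ascFactorial (2 * J - j - l) : ℚ) ^ (e + 2 + 1) = Z
  generalize shiftedProd (2 * J) n = Δ
  push_cast at h6 ⊢
  field_simp
  rw [pow_two ((-1 : ℚ) ^ w), h7]
  ring

theorem rowTerm_eq {e J j l t n u w : ℕ} (h : n + 2 * J = u + j + (w + l)) (ht : t < l)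
    (hjl : j + l ≤ 2 * J) :
    scaledBinom J j l n (u + j) ^ (e + 3) * potentialScale J n (u + j)
      * (wzPotential (u + j + (w + t + 1)) (u + j) - wzPotential (u + j + (w + t)) (u + j))
      = rowTerm e J j l t n (u + j) := by
  have hq : (n : ℚ) + 2 * J = u + j + (w + l) := by exact_mod_cast h
  have hs : n + 2 * J - (u + j) = w + l := by omega
  have h1 : (n : ℚ) + 2 * J - (u + j : ℕ) = (w : ℚ) + l := by push_cast; linarith
  have h3 : (n : ℚ) + 2 * J + (u + j : ℕ)
      = ((2 * (u + j) + (w + t) + 1 : ℕ) : ℚ) + (l - t - 1 : ℕ) := by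
    have : n + 2 * J + (u + j) = (2 * (u + j) + (w + t) + 1) + (l - t - 1) := by omega
    exact_mod_cast this
  have h4 : n + 2 * J + (u + j) = (2 * (u + j) + (w + t) + 1) + (l - t - 1) := by omega
  have h5 : (n : ℚ) + (2 * J - l + t : ℕ) + 1 = (u + j : ℕ) + (w + t : ℕ) + 1 := by
    have : n + (2 * J - l + t) = u + j + (w + t) := by omega
    exact_mod_cast congrArg (· + 1) this
  have h6 : ((u + j : ℕ) : ℚ) + (w + t : ℕ) + 1 ≠ 0 := by positivity
  have h7 : ((-1 : ℚ) ^ w) * (-1) ^ w = 1 := by rw [← mul_pow]; norm_num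
  rw [wzPotential_add_one_sub]
  unfold rowTerm scaledBinom potentialScale
  rw [h5, h3, h1, h4, hs, descPochhammer_eval_natCast_add,
    add_sub_cancel_right, descPochhammer_eval_natCast_add, descPochhammer_eval_natCast_add,
    mul_pow, mul_pow, pow_add _ w l, pow_add _ w t, pow_add _ l t,
    show e + 3 = e + 2 + 1 from rfl, pow_succ (_ / (w.factorial : ℚ)) (e + 2)]
  generalize ((descPochhammer ℚ j).eval ((u + j : ℕ) : ℚ)) ^ (e + 2 + 1) = A
  generalize ((w + l).factorial / w.factorial : ℚ) ^ (e + 2) = B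
  generalize ((n + 1).ascFactorial (2 * J - j - l) : ℚ) ^ (e + 2 + 1) = Z
  generalize shiftedProd (2 * J) n = Δ
  push_cast at h6 ⊢
  field_simp
  rw [pow_two ((-1 : ℚ) ^ w), h7]
  ring

theorem scaledDiff_eq {e J j l n u w : ℕ} (h : n + 2 * J = u + j + (w + l))
    (hjl : j + l ≤ 2 * J) :
    scaledBinom J j l n (u + j) ^ (e + 3) * potentialScale J n (u + j)
      * (wzPotential (n + 2 * J) (u + j) - wzPotential (u + w) u)
      = scaledDiff e J j l n (u + j) := by
  rw [h, wzPotential_add_add_sub, mul_add, Finset.mul_sum, Finset.mul_sum]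
  unfold scaledDiff
  congr 1
  · exact Finset.sum_congr rfl fun t ht => diagTerm_eq h (Finset.mem_range.1 ht) hjl
  · exact Finset.sum_congr rfl fun t ht => rowTerm_eq h (Finset.mem_range.1 ht) hjl

/-! ### Degree bounds in `k` -/

theorem isPolyOfDegreeLE_complement (J : ℕ) :
    IsPolyOfDegreeLE 1 (fun n k => (n : ℚ) + 2 * J - k) :=
  ((IsPolyOfDegreeLE.fst.add (IsPolyOfDegreeLE.const (2 * J))).mono zero_le_one).sub
    IsPolyOfDegreeLE.snd

theorem isPolyOfDegreeLE_ascFactorial (a : ℕ) :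
    IsPolyOfDegreeLE 0 (fun n _ => ((n + 1).ascFactorial a : ℚ)) := by
  have h := (IsPolyOfDegreeLE.fst.add (IsPolyOfDegreeLE.const 1)).eval (ascPochhammer ℚ a)
  rw [mul_zero] at h
  convert h using 3 with n k
  rw [Nat.cast_ascFactorial]
  push_cast
  rfl

theorem isPolyOfDegreeLE_scaledBinom {J j l : ℕ} (hj : j ≤ J) (hl : l ≤ J) :
    IsPolyOfDegreeLE (2 * J) (scaledBinom J j l) :=
  (((isPolyOfDegreeLE_ascFactorial _).mul (IsPolyOfDegreeLE.snd.descPochhammer j)).mul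
    ((isPolyOfDegreeLE_complement J).descPochhammer l)).mono (by omega)

theorem isPolyOfDegreeLE_diagTerm (e : ℕ) {J j l t : ℕ} (hj : j ≤ J) (hl : l ≤ J) (ht : t < j) :
    IsPolyOfDegreeLE ((2 * e + 8) * J + 1) (diagTerm e J j l t) := by
  have hA := (isPolyOfDegreeLE_ascFactorial (2 * J - j - l)).pow (e + 3)
  have hB := ((IsPolyOfDegreeLE.snd.descPochhammer j).mono hj).pow (e + 1)
  have hC := (((isPolyOfDegreeLE_complement J).descPochhammer l).mono hl).pow (e + 2)
  have hu : IsPolyOfDegreeLE 1 (fun _ k => (k : ℚ) - j + t) :=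
    (IsPolyOfDegreeLE.snd.sub ((IsPolyOfDegreeLE.const j).mono zero_le_one)).add
      ((IsPolyOfDegreeLE.const t).mono zero_le_one)
  have hD := (IsPolyOfDegreeLE.const ((-1) ^ l)).mul ((hu.descPochhammer t).pow 2)
  have hw := (isPolyOfDegreeLE_complement J).sub ((IsPolyOfDegreeLE.const l).mono zero_le_one)
  have h3 := (((IsPolyOfDegreeLE.const 3).mul hu).add (hw.mono (by omega))).add
    ((IsPolyOfDegreeLE.const 3).mono (Nat.zero_le _))
  have hm := ((IsPolyOfDegreeLE.fst.add (IsPolyOfDegreeLE.const (2 * J))).mono zero_le_one).add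
    IsPolyOfDegreeLE.snd
  have hE := hm.descPochhammer (2 * (j - t - 1) + l)
  have hF := isPolyOfDegreeLE_shiftedProd_div (r := 2 * J) (a := 2 * J - j - l + t) (by omega)
  refine (((hA.mul hB).mul hC).mul (((hD.mul h3).mul hE).mul hF)).mono ?_
  have : 2 * t + (2 * (j - t - 1) + l) ≤ 3 * J := by omega
  nlinarith

theorem isPolyOfDegreeLE_rowTerm (e : ℕ) {J j l t : ℕ} (hj : j ≤ J) (hl : l ≤ J) (ht : t < l) :
    IsPolyOfDegreeLE ((2 * e + 8) * J + 1) (rowTerm e J j l t) := by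
  have hA := (isPolyOfDegreeLE_ascFactorial (2 * J - j - l)).pow (e + 3)
  have hB := ((IsPolyOfDegreeLE.snd.descPochhammer j).mono hj).pow (e + 3)
  have hC := (((isPolyOfDegreeLE_complement J).descPochhammer l).mono hl).pow (e + 2)
  have hw := ((isPolyOfDegreeLE_complement J).sub
    ((IsPolyOfDegreeLE.const l).mono zero_le_one)).add
    ((IsPolyOfDegreeLE.const t).mono zero_le_one)
  have hD := (IsPolyOfDegreeLE.const (2 * (-1) ^ (l + t))).mul (hw.descPochhammer t)
  have hm := ((IsPolyOfDegreeLE.fst.add (IsPolyOfDegreeLE.const (2 * J))).mono zero_le_one).add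
    IsPolyOfDegreeLE.snd
  have hE := hm.descPochhammer (l - t - 1)
  have hF := isPolyOfDegreeLE_shiftedProd_div (r := 2 * J) (a := 2 * J - l + t) (by omega)
  refine (((hA.mul hB).mul hC).mul ((hD.mul hE).mul hF)).mono ?_
  have : t + (l - t - 1) ≤ J := by omega
  nlinarith

theorem isPolyOfDegreeLE_scaledDiff (e : ℕ) {J j l : ℕ} (hj : j ≤ J) (hl : l ≤ J) :
    IsPolyOfDegreeLE ((2 * e + 8) * J + 1) (scaledDiff e J j l) :=
  (IsPolyOfDegreeLE.sum _ fun _ ht =>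
    isPolyOfDegreeLE_diagTerm e hj hl (Finset.mem_range.1 ht)).add
  (IsPolyOfDegreeLE.sum _ fun _ ht =>
    isPolyOfDegreeLE_rowTerm e hj hl (Finset.mem_range.1 ht))

/-! ### Counting unknowns against equations -/

theorem exists_relation_scaledBinom_scaledDiff (e : ℕ) :
    ∃ (J : ℕ) (c : Fin (J + 1) × Fin (J + 1) → Polynomial ℚ), (∃ p, c p ≠ 0) ∧ ∀ n k : ℕ,
      ∑ p, (c p).eval (n : ℚ) * scaledBinom J p.1 p.2 n k ^ (e + 3) = 0 ∧
      ∑ p, (c p).eval (n : ℚ) * scaledDiff e J p.1 p.2 n k = 0 := by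
  -- With `D = (2e+8)J + 1` this makes `2(D+1) = J² + 4`, below the number `(J+1)²` of unknowns.
  set J := 4 * e + 16 with hJ
  have hle : ∀ i : Fin (J + 1), (i : ℕ) ≤ J := fun i => Nat.lt_succ_iff.1 i.2
  have hR : ∀ p : Fin (J + 1) × Fin (J + 1), IsPolyOfDegreeLE ((2 * e + 8) * J + 1)
      (fun n k => scaledBinom J p.1 p.2 n k ^ (e + 3)) := fun p =>
    ((isPolyOfDegreeLE_scaledBinom (hle p.1) (hle p.2)).pow (e + 3)).mono (by nlinarith)
  have hS : ∀ p : Fin (J + 1) × Fin (J + 1), IsPolyOfDegreeLE ((2 * e + 8) * J + 1)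
      (scaledDiff e J p.1 p.2) := fun p =>
    isPolyOfDegreeLE_scaledDiff e (hle p.1) (hle p.2)
  choose R hRd hRe using hR
  choose S hSd hSe using hS
  obtain ⟨c, hc, h1, h2⟩ := exists_nontrivial_relation_of_natDegree_le _ R S hRd hSd
    (by rw [Fintype.card_prod, Fintype.card_fin]; nlinarith)
  refine ⟨J, c, hc, fun n k => ⟨?_, ?_⟩⟩
  · have := congrArg (fun P => (P.eval (Polynomial.C (k : ℚ))).eval (n : ℚ)) h1
    refine (Finset.sum_congr rfl fun p _ => congrArg (_ * ·) (hRe p n k)).trans ?_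
    simpa [Polynomial.eval_finsetSum] using this
  · have := congrArg (fun P => (P.eval (Polynomial.C (k : ℚ))).eval (n : ℚ)) h2
    refine (Finset.sum_congr rfl fun p _ => congrArg (_ * ·) (hSe p n k)).trans ?_
    simpa [Polynomial.eval_finsetSum] using this

/-! ### From relations between shifts to recurrences for row sums -/

open Polynomial in
/-- The generating polynomial of the `n`-th row of a triangular array. -/
noncomputable def rowPoly (a : ℕ → ℕ → ℚ) (n : ℕ) : ℚ[X] :=
  ∑ k ∈ Finset.range (n + 1), C (a n k) * X ^ k

theorem rowPoly_coeff {a : ℕ → ℕ → ℚ} (ha : ∀ n k, n < k → a n k = 0) (n k : ℕ) :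
    (rowPoly a n).coeff k = a n k := by
  simp only [rowPoly, Polynomial.finsetSum_coeff, Polynomial.coeff_C_mul_X_pow]
  simp only [Finset.sum_ite_eq, Finset.mem_range]
  split_ifs with h
  · rfl
  · exact (ha n k (by omega)).symm

open Polynomial in
/-- A relation between shifts of the rows of a triangular array gives a recurrence for the
row sums; the recurrence only depends on the coefficients of the relation. -/
theorem exists_recurrence_of_relation (J : ℕ) (c : Fin (J + 1) × Fin (J + 1) → ℚ[X])
    (hc : ∃ p, c p ≠ 0) :
    ∃ (L : ℕ) (p : ℕ → ℚ[X]), (∀ n : ℕ, (p L).eval (n : ℚ) ≠ 0) ∧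
      ∀ a : ℕ → ℕ → ℚ, (∀ n k, n < k → a n k = 0) →
        (∀ n k : ℕ, ∑ p, (c p).eval (n : ℚ) *
          (if (p.1 : ℕ) ≤ k then a (n + (2 * J - p.1 - p.2)) (k - p.1) else 0) = 0) →
        SatisfiesRecurrence L p (fun n => ∑ k ∈ Finset.range (n + 1), a n k) := by
  classical
  let deg : Fin (J + 1) × Fin (J + 1) → ℕ := fun p => 2 * J - p.1 - p.2
  let Q : ℕ → ℚ[X][X] := fun i => ∑ p with deg p = i, C (c p) * X ^ (p.1 : ℕ)
  have hQ : ∃ i ≤ 2 * J, Q i ≠ 0 := by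
    obtain ⟨p, hp⟩ := hc
    refine ⟨deg p, by simp only [deg]; omega, fun h => hp ?_⟩
    have h1 := congrArg (fun P => P.coeff (p.1 : ℕ)) h
    simp only [Q, finsetSum_coeff, coeff_C_mul_X_pow, coeff_zero] at h1
    rw [Finset.sum_eq_single p] at h1
    · simpa using h1
    · intro q hq hqp
      rw [if_neg]
      intro h2
      -- The power of `x` gives `j` and the shift `2J-j-l` then gives `l`, so distinct unknowns
      -- never merge in `Q`.
      apply hqp
      have h3 : deg q = deg p := (Finset.mem_filter.1 hq).2
      simp only [deg] at h3
      have := p.1.2; have := p.2.2; have := q.2.2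
      exact Prod.ext (Fin.ext h2.symm) (Fin.ext (by omega))
    · simp
  obtain ⟨L, p, hp, hrec⟩ := exists_recurrence_eval_one (2 * J) Q hQ
  refine ⟨L, p, hp, fun a ha hrel => ?_⟩
  have h := hrec (rowPoly a) fun n => ?_
  · simpa [rowPoly, eval_finsetSum] using h
  have h1 : ∑ i ∈ Finset.range (2 * J + 1), (Q i).map (evalRingHom (n : ℚ)) * rowPoly a (n + i)
      = ∑ p, C ((c p).eval (n : ℚ)) * (X ^ (p.1 : ℕ) * rowPoly a (n + deg p)) := by
    rw [← Finset.sum_fiberwise_of_maps_to (s := Finset.univ) (t := Finset.range (2 * J + 1))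
      (g := deg) (fun q _ => by simp only [deg, Finset.mem_range]; omega)]
    refine Finset.sum_congr rfl fun i _ => ?_
    rw [Polynomial.map_sum, Finset.sum_mul]
    refine Finset.sum_congr rfl fun q hq => ?_
    rw [(Finset.mem_filter.1 hq).2]
    simp [mul_assoc]
  rw [h1]
  ext k
  rw [finsetSum_coeff, coeff_zero, ← hrel n k]
  refine Finset.sum_congr rfl fun q _ => ?_
  rw [coeff_C_mul, coeff_X_pow_mul', rowPoly_coeff ha]

/-! ### The common recurrence -/

/-- The factor that turns powers of shifted binomial coefficients into polynomials. -/
def binomScale (e J n k : ℕ) : ℚ :=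
  ((k.factorial : ℚ) * (n + 2 * J - k).factorial / n.factorial) ^ (e + 3)

theorem binomScale_ne_zero (e J n k : ℕ) : binomScale e J n k ≠ 0 := by
  unfold binomScale
  positivity

theorem binomScale_mul_choose {e J j l n k : ℕ} (hk : k ≤ n + 2 * J) (hjl : j + l ≤ 2 * J) :
    binomScale e J n k *
      (if j ≤ k then ((n + (2 * J - j - l)).choose (k - j) : ℚ) ^ (e + 3) else 0)
      = scaledBinom J j l n k ^ (e + 3) := by
  by_cases h : j ≤ k ∧ l ≤ n + 2 * J - k
  · obtain ⟨u, rfl⟩ := Nat.exists_eq_add_of_le' h.1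
    obtain ⟨w, hw⟩ := Nat.exists_eq_add_of_le' h.2
    rw [if_pos h.1, ← scaledBinom_eq (w := w) (by omega) hjl, binomScale, hw,
      show n + (2 * J - j - l) = u + w by omega, Nat.add_sub_cancel, ← mul_pow]
  · rw [scaledBinom_eq_zero hk h]
    split_ifs with hj
    · rw [Nat.choose_eq_zero_of_lt (by omega)]
      simp
    · simp

theorem binomScale_mul_choose_mul_potential {e J j l n k : ℕ} (hk : k ≤ n + 2 * J)
    (hjl : j + l ≤ 2 * J) :
    binomScale e J n k * potentialScale J n k *
      (if j ≤ k then ((n + (2 * J - j - l)).choose (k - j) : ℚ) ^ (e + 3)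
        * wzPotential (n + (2 * J - j - l)) (k - j) else 0)
      = potentialScale J n k * wzPotential (n + 2 * J) k * scaledBinom J j l n k ^ (e + 3)
        - scaledDiff e J j l n k := by
  have hb := binomScale_mul_choose (e := e) hk hjl
  by_cases h : j ≤ k ∧ l ≤ n + 2 * J - k
  · obtain ⟨u, rfl⟩ := Nat.exists_eq_add_of_le' h.1
    obtain ⟨w, hw⟩ := Nat.exists_eq_add_of_le' h.2
    rw [if_pos h.1] at hb ⊢
    have hd := scaledDiff_eq (e := e) (show n + 2 * J = u + j + (w + l) by omega) hjl
    rw [← hd, ← hb, show n + (2 * J - j - l) = u + w by omega, Nat.add_sub_cancel]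
    ring
  · rw [scaledDiff_eq_zero hk h, ← hb]
    split_ifs with hj
    · rw [Nat.choose_eq_zero_of_lt (by omega)]
      simp
    · simp

theorem exists_common_recurrence (e : ℕ) :
    ∃ (L : ℕ) (p : ℕ → Polynomial ℚ), (∀ n : ℕ, (p L).eval (n : ℚ) ≠ 0) ∧
      SatisfiesRecurrence L p (binomPowSum (e + 3)) ∧
      SatisfiesRecurrence L p (binomPowPotentialSum (e + 3)) := by
  obtain ⟨J, c, hc, hrel⟩ := exists_relation_scaledBinom_scaledDiff e
  obtain ⟨L, p, hp, hrec⟩ := exists_recurrence_of_relation J c hc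
  have hjl : ∀ q : Fin (J + 1) × Fin (J + 1), (q.1 : ℕ) + q.2 ≤ 2 * J := fun q => by omega
  have hA := hrec (fun n k => (n.choose k : ℚ) ^ (e + 3))
    (fun n k h => by simp [Nat.choose_eq_zero_of_lt h]) fun n k => by
      by_cases hk : k ≤ n + 2 * J
      · refine (mul_eq_zero.1 ?_).resolve_left (binomScale_ne_zero e J n k)
        refine Eq.trans ?_ (hrel n k).1
        rw [Finset.mul_sum]
        refine Finset.sum_congr rfl fun q _ => ?_
        rw [← binomScale_mul_choose hk (hjl q)]
        ring
      · refine Finset.sum_eq_zero fun q _ => ?_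
        have := hjl q
        rw [Nat.choose_eq_zero_of_lt (by omega)]
        simp
  have hB := hrec (fun n k => (n.choose k : ℚ) ^ (e + 3) * wzPotential n k)
    (fun n k h => by simp [Nat.choose_eq_zero_of_lt h]) fun n k => by
      by_cases hk : k ≤ n + 2 * J
      · refine (mul_eq_zero.1 ?_).resolve_left
          (mul_ne_zero (binomScale_ne_zero e J n k) (potentialScale_ne_zero J n k))
        -- The potential at `(n+2J, k)` does not depend on the summation index, so it multiplies the
        -- first relation as a whole; the differences form the second.
        have h0 : potentialScale J n k * wzPotential (n + 2 * J) k
            * ∑ q, (c q).eval (n : ℚ) * scaledBinom J q.1 q.2 n k ^ (e + 3)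
            - ∑ q, (c q).eval (n : ℚ) * scaledDiff e J q.1 q.2 n k = 0 := by
          rw [(hrel n k).1, (hrel n k).2]
          ring
        refine Eq.trans ?_ h0
        rw [Finset.mul_sum, Finset.mul_sum, ← Finset.sum_sub_distrib]
        refine Finset.sum_congr rfl fun q _ => ?_
        have hq := binomScale_mul_choose_mul_potential (e := e) hk (hjl q)
        linear_combination (c q).eval (n : ℚ) * hq
      · refine Finset.sum_eq_zero fun q _ => ?_
        have := hjl q
        rw [Nat.choose_eq_zero_of_lt (by omega)]
        simp
  refine ⟨L, p, hp, hA, fun n => ?_⟩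
  have h := hB n
  unfold binomPowPotentialSum
  calc _ = 1 / (((e + 3 : ℕ) : ℚ) + 1) * ∑ i ∈ Finset.range (L + 1), (p i).eval (n : ℚ)
        * ∑ k ∈ Finset.range (n + i + 1), ((n + i).choose k : ℚ) ^ (e + 3)
          * wzPotential (n + i) k := by
        rw [Finset.mul_sum]
        exact Finset.sum_congr rfl fun i _ => by ring
    _ = 0 := by rw [h, mul_zero]

theorem theorem1 (d : ℕ) (hd : 3 ≤ d) :
    (∃ (L : ℕ) (p : ℕ → Polynomial ℚ),
      (∀ n : ℕ, (p L).eval (n : ℚ) ≠ 0) ∧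
      SatisfiesRecurrence L p (binomPowSum d) ∧
      SatisfiesRecurrence L p (binomPowPotentialSum d)) ∧
    (∃ C α : ℝ, 1 < α ∧ ∀ n : ℕ,
      ‖((binomPowPotentialSum d n / binomPowSum d n : ℚ) : ℂ) - riemannZeta 2 / ((d : ℂ) + 1)‖
        ≤ C / α ^ n) := by
  refine ⟨?_, 12, 3 / 2, by norm_num, fun n =>
    norm_potential_ratio_sub_zeta_le d n (by omega)⟩
  obtain ⟨e, rfl⟩ := Nat.exists_eq_add_of_le' hd
  exact exists_common_recurrence e
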